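/- For subsets $A,B,C\subseteq\{0,1\}^n$ let $f_{(A,B,C)}:\{0,1\}^{n+2}\to\{0,1\}$ be the Boolean function whose value at $(x,a)$, $x\in\{0,1\}^n$, $a\in\{0,1\}^2$, is $\mathbf 1_{x\in A}$ if $a=00$, $\mathbf 1_{x\in B}$ if $a=01$, $\mathbf 1_{x\in C}$ if $a=10$, and $0$ if $a=11$. Put $$F_0=\{f_{(A,B,C)}: |A\cap B\cap C|/2^n\ge 1/16\},\qquad F_1=\{f_{(A,B,A\Delta B)}: A,B\subseteq\{0,1\}^n\},$$ where $\Delta$ denotes symmetric difference. The function state of $f:\{0,1\}^m\to\{0,1\}$ is $|f\rangle=2^{-m/2}\sum_{z\in\{0,1\}^m}|z,f(z)\rangle$. A passive quantum tester using $t$ copies is an arbitrary two-outcome quantum measurement (POVM) applied to $|f\rangle^{\otimes t}$. A $q$-query classical algorithm is a randomized adaptive algorithm that evaluates $f$ at no more than $q$ points and outputs one bit. Either one distinguishes $F_0$ and $F_1$ with probability $2/3$ if, for each $i\in\{0,1\}$ and each $f\in F_i$, it outputs $i$ with probability at least $2/3$. Let $$\mathcal E_0=\mathbb E_{A,B,C}\big[|f_{(A,B,C)}\rangle\langle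 f_{(A,B,C)}|^{\otimes t}\big],\qquad \mathcal E_1=\mathbb E_{A,B}\big[|f_{(A,B,A\Delta B)}\rangle\langle f_{(A,B,A\Delta B)}|^{\otimes t}\big],$$ where $A,B,C$ are independent uniformly random subsets of $\{0,1\}^n$, and let $\Pi$ be the orthogonal projector onto the span of those computational basis states $|x_1,a_1,b_1,\dots,x_t,a_t,b_t\rangle$ ($x_j\in\{0,1\}^n$, $a_j\in\{0,1\}^2$, $b_j\in\{0,1\}$) for which $x_1,\dots,x_t$ are pairwise distinct. Write $\|\cdot\|_1$ for the trace norm when applied to operators. Theorem. For all integers $n,t\ge 0$ the following hold, with constants that are absolute (independent of $n$ and $t$). 1. $F_0$ and $F_1$ are non-empty, and $\|f_0-f_1\|_1=\mathbb E_{z}|f_0(z)-f_1(z)|\ge 1/64$ for all $f_0\in F_0$, $f_1\in F_1$, where $z$ is uniform on $\{0,1\}^{n+2}$. 2. Any passive quantum tester that distinguishes $F_0$ and $F_1$ with probability $2/3$ needs $\Omega(2^{n/2})$ function state copies: there is a constant $c>0$ such that it must use $t\ge c\,2^{n/2}$ copies. 3. $F_0$ and $F_1$ can be distinguished with probability $2/3$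 by a classical algorithm making $\mathcal O(1)$ queries. 4. $\Pi\mathcal E_0\Pi=\Pi\mathcal E_1\Pi$. 5. $\|\mathcal E_0-\Pi\mathcal E_0\Pi\|_1$, $\|\mathcal E_1-\Pi\mathcal E_1\Pi\|_1$ and $\|\mathcal E_0-\mathcal E_1\|_1$ are all at most $\mathcal O(t/2^{n/2})$. -/

import Mathlib

open scoped BigOperators ComplexOrder

noncomputable section

/-- The Boolean cube `{0,1}^n`. -/
abbrev Cube (n : ℕ) : Type := Fin n → Bool

/-- Bit strings of length `n + 2`, written as pairs `(x, a)` with `x` of length `n` and `a` of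
length `2`. -/
abbrev Input (n : ℕ) : Type := Cube n × (Bool × Bool)

/-! ### The Boolean functions encoding triples of sets -/

/-- The function `f_{(A,B,C)}`: on `(x, a)` it is the indicator of `x ∈ A`, `x ∈ B`, `x ∈ C` for
`a = 00, 01, 10` respectively, and it is `0` for `a = 11`. -/
def tripleFun {n : ℕ} (A B C : Finset (Cube n)) : Input n → Bool
  | (x, (false, false)) => decide (x ∈ A)
  | (x, (false, true)) => decide (x ∈ B)
  | (x, (true, false)) => decide (x ∈ C)
  | (_, (true, true)) => false

/-- The functions `f_{(A,B,C)}` with `|A ∩ B ∩ C| / 2^n ≥ 1/16`. -/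
def familyZero (n : ℕ) : Set (Input n → Bool) :=
  {f | ∃ A B C : Finset (Cube n),
    (1 / 16 : ℝ) ≤ ((A ∩ B ∩ C).card : ℝ) / 2 ^ n ∧ f = tripleFun A B C}

/-- The functions `f_{(A,B,A Δ B)}`. -/
def familyOne (n : ℕ) : Set (Input n → Bool) :=
  {f | ∃ A B : Finset (Cube n), f = tripleFun A B (symmDiff A B)}

/-- Normalized `L¹` distance of Boolean functions, `𝔼_x |f x - g x|` with `x` uniform. -/
def l1Dist {X : Type} [Fintype X] (f g : X → Bool) : ℝ :=
  (∑ x, |((f x).toNat : ℝ) - ((g x).toNat : ℝ)|) / Fintype.card X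

/-! ### Function states and passive quantum testers -/

/-- Computational basis labels of `t` registers, each holding an input and an output bit. -/
abbrev Register (X : Type) (t : ℕ) : Type := Fin t → X × Bool

/-- The function state `|f⟩ = |X|^{-1/2} ∑_x |x, f x⟩`, as a coordinate vector. -/
def functionState {X : Type} [Fintype X] (f : X → Bool) : X × Bool → ℂ :=
  fun p => if f p.1 = p.2 then ((1 / Real.sqrt (Fintype.card X) : ℝ) : ℂ) else 0

/-- The rank-one operator `|ψ⟩⟨ψ|`. -/
def ketBra {I : Type} (ψ : I → ℂ) : Matrix I I ℂ := Matrix.vecMulVec ψ (star ψ)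

/-- The tensor power `ρ^{⊗ t}`, in the product basis. -/
def tensorPower {I : Type} (ρ : Matrix I I ℂ) (t : ℕ) : Matrix (Fin t → I) (Fin t → I) ℂ :=
  Matrix.of fun r s => ∏ j, ρ (r j) (s j)

/-- The state `|f⟩⟨f|^{⊗ t}` of `t` copies of the function state. -/
def copies {X : Type} [Fintype X] (f : X → Bool) (t : ℕ) :
    Matrix (Register X t) (Register X t) ℂ :=
  tensorPower (ketBra (functionState f)) t

/-- A passive quantum tester that uses `t` function state copies: an arbitrary two-outcome quantum
measurement (POVM) on the joint `t`-copy system. Every quantum algorithm that acts on the copies,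
with any ancillas and intermediate measurements, and outputs a bit, is of this form. -/
structure PassiveQuantumTester (X : Type) [Fintype X] [DecidableEq X] (t : ℕ) where
  effect : Bool → Matrix (Register X t) (Register X t) ℂ
  posSemidef : ∀ b, (effect b).PosSemidef
  sum_eq_one : ∑ b, effect b = 1

/-- The probability (Born rule) that the tester outputs `b` on `t` copies of `|f⟩`. -/
def PassiveQuantumTester.prob {X : Type} [Fintype X] [DecidableEq X] {t : ℕ}
    (M : PassiveQuantumTester X t) (f : X → Bool) (b : Bool) : ℝ :=
  (M.effect b * copies f t).trace.re

/-- The tester distinguishes `F₀` from `F₁` with probability at least `p`: it outputs `0` on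
members of `F₀` and `1` on members of `F₁`, with probability at least `p` each time. -/
def PassiveQuantumTester.Distinguishes {X : Type} [Fintype X] [DecidableEq X] {t : ℕ}
    (M : PassiveQuantumTester X t) (F₀ F₁ : Set (X → Bool)) (p : ℝ) : Prop :=
  (∀ f ∈ F₀, p ≤ M.prob f false) ∧ (∀ f ∈ F₁, p ≤ M.prob f true)

/-! ### Classical query algorithms -/

/-- Deterministic adaptive query algorithms with a one-bit output. -/
inductive DecisionTree (X : Type) : Type
  | leaf (b : Bool) : DecisionTree X
  | query (x : X) (next : Bool → DecisionTree X) : DecisionTree X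

/-- The output of the algorithm when its queries are answered by `f`. -/
def DecisionTree.eval {X : Type} (f : X → Bool) : DecisionTree X → Bool
  | .leaf b => b
  | .query x next => (next (f x)).eval f

/-- The worst-case number of queries. -/
def DecisionTree.depth {X : Type} : DecisionTree X → ℕ
  | .leaf _ => 0
  | .query _ next => max (next false).depth (next true).depth + 1

/-- A randomized classical algorithm making at most `q` queries: a probability distribution on
deterministic adaptive algorithms making at most `q` queries. -/
structure QueryAlgorithm (X : Type) (q : ℕ) where
  dist : PMF (DecisionTree X)
  depth_le : ∀ T ∈ dist.support, T.depth ≤ q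

/-- The probability that the algorithm outputs `b` when its queries are answered by `f`. -/
def QueryAlgorithm.prob {X : Type} {q : ℕ} (R : QueryAlgorithm X q) (f : X → Bool) (b : Bool) : ℝ :=
  ((R.dist.map (DecisionTree.eval f)) b).toReal

/-- The algorithm distinguishes `F₀` from `F₁` with probability at least `p`. -/
def QueryAlgorithm.Distinguishes {X : Type} {q : ℕ} (R : QueryAlgorithm X q)
    (F₀ F₁ : Set (X → Bool)) (p : ℝ) : Prop :=
  (∀ f ∈ F₀, p ≤ R.prob f false) ∧ (∀ f ∈ F₁, p ≤ R.prob f true)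

/-! ### The averaged `t`-copy states -/

/-- `𝔼_{A,B,C} |f_{(A,B,C)}⟩⟨f_{(A,B,C)}|^{⊗ t}` with `A, B, C` independent uniform subsets of
`{0,1}^n`. -/
def ensembleZero (n t : ℕ) : Matrix (Register (Input n) t) (Register (Input n) t) ℂ :=
  ((Fintype.card (Finset (Cube n)) : ℂ) ^ 3)⁻¹ •
    ∑ A : Finset (Cube n), ∑ B : Finset (Cube n), ∑ C : Finset (Cube n),
      copies (tripleFun A B C) t

/-- `𝔼_{A,B} |f_{(A,B,A Δ B)}⟩⟨f_{(A,B,A Δ B)}|^{⊗ t}` with `A, B` independent uniform subsets of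
`{0,1}^n`. -/
def ensembleOne (n t : ℕ) : Matrix (Register (Input n) t) (Register (Input n) t) ℂ :=
  ((Fintype.card (Finset (Cube n)) : ℂ) ^ 2)⁻¹ •
    ∑ A : Finset (Cube n), ∑ B : Finset (Cube n), copies (tripleFun A B (symmDiff A B)) t

/-- The orthogonal projector onto the span of the basis states `|x₁,a₁,b₁,…,x_t,a_t,b_t⟩` for which
the strings `x₁,…,x_t ∈ {0,1}^n` are pairwise distinct. -/
def distinctProj (n t : ℕ) : Matrix (Register (Input n) t) (Register (Input n) t) ℂ :=
  Matrix.diagonal fun r => if Function.Injective (fun j => (r j).1.1) then 1 else 0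

/-- The trace norm `‖M‖₁`: the sum of the singular values of `M`, that is, of the square roots of
the eigenvalues of `Mᴴ M`. -/
def traceNorm {I : Type} [Fintype I] [DecidableEq I] (M : Matrix I I ℂ) : ℝ :=
  ∑ i, Real.sqrt ((Matrix.isHermitian_conjTranspose_mul_self M).eigenvalues i)

end

/-! A table (u, v, u ⊕ v) with u, v uniform is pairwise independent, so any two of its bits look
exactly like two bits of a uniform triple. Take a matrix entry of an averaged state whose row and
column labels both have distinct strings. At each point x the row tests at most one table bit and
the column at most one, so at most two in all. The expectation factors over points, and the two
ensembles agree on the range of Π (`sum_tableTest_mul`, `ensembleZero_apply_eq_ensembleOne_apply`).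

Outside that range the weight of a t-copy state is the collision probability of t uniform strings,
at most t²/2^n (`card_not_injective_mul_le`). Cutting a unit vector down to a coordinate subspace
moves its state by at most twice the norm of the removed part, here 2t/2^{n/2}. This bounds the
trace of the difference against any contraction, hence also the trace norm
(`exists_isContractive_trace_eq_traceNorm`) and the bias of a tester, whose effects are
contractions.

For the lower bound, parity triples always lie in F₁, while by Chebyshev a random triple lies in F₀
except with probability 256/2^n (`card_sparse_mul_le`). A good tester would therefore separate two
nearly equal averages. Classical queries can read three bits at the same x, and the pattern 111 is
impossible for parity triples but has density at least 1/16 in F₀, so constantly many samples find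
it. -/

open Matrix

/-! ### Contractions and the trace norm -/

/-- The Euclidean norm of a coordinate vector. -/
noncomputable def l2Norm {I : Type} [Fintype I] (v : I → ℂ) : ℝ := ‖WithLp.toLp 2 v‖

/-- The matrix `U` has operator norm at most one, expressed by its sesquilinear form. -/
def IsContractive {I : Type} [Fintype I] (U : Matrix I I ℂ) : Prop :=
  ∀ u v : I → ℂ, ‖star v ⬝ᵥ U *ᵥ u‖ ≤ l2Norm v * l2Norm u

section Contractive

variable {I : Type} [Fintype I]

lemma l2Norm_nonneg (v : I → ℂ) : 0 ≤ l2Norm v := norm_nonneg _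

lemma norm_star_dotProduct_le (v u : I → ℂ) : ‖star v ⬝ᵥ u‖ ≤ l2Norm v * l2Norm u := by
  have h := norm_inner_le_norm (𝕜 := ℂ) (WithLp.toLp 2 v) (WithLp.toLp 2 u)
  rwa [EuclideanSpace.inner_toLp_toLp, dotProduct_comm] at h

lemma l2Norm_sq (v : I → ℂ) : l2Norm v ^ 2 = ∑ i, ‖v i‖ ^ 2 := by
  rw [l2Norm, EuclideanSpace.norm_sq_eq]

lemma star_dotProduct_self (v : I → ℂ) : star v ⬝ᵥ v = ((l2Norm v ^ 2 : ℝ) : ℂ) := by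
  rw [l2Norm_sq]
  simp only [dotProduct, Pi.star_apply, Complex.ofReal_sum]
  refine Finset.sum_congr rfl fun i _ => ?_
  rw [RCLike.star_def, Complex.conj_mul']
  push_cast; rfl

/-- The quadratic form of 1 - A Aᴴ at v is ‖v‖² - ‖Aᴴ v‖². -/
lemma l2Norm_conjTranspose_mulVec_le [DecidableEq I] {A : Matrix I I ℂ}
    (h : (1 - A * Aᴴ).PosSemidef) (v : I → ℂ) : l2Norm (Aᴴ *ᵥ v) ≤ l2Norm v := by
  have h1 := h.dotProduct_mulVec_nonneg v
  have h2 : star v ⬝ᵥ ((1 - A * Aᴴ) *ᵥ v) =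
      ((l2Norm v ^ 2 - l2Norm (Aᴴ *ᵥ v) ^ 2 : ℝ) : ℂ) := by
    rw [sub_mulVec, dotProduct_sub, one_mulVec, star_dotProduct_self, Complex.ofReal_sub,
      ← star_dotProduct_self (Aᴴ *ᵥ v), star_mulVec, conjTranspose_conjTranspose,
      ← dotProduct_mulVec, mulVec_mulVec]
  rw [h2, Complex.zero_le_real] at h1
  exact le_of_sq_le_sq (by linarith) (l2Norm_nonneg v)

lemma isContractive_of_posSemidef_one_sub_mul_conjTranspose [DecidableEq I] {U : Matrix I I ℂ}
    (h : (1 - U * Uᴴ).PosSemidef) : IsContractive U := by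
  intro u v
  have h1 : star v ⬝ᵥ U *ᵥ u = star (Uᴴ *ᵥ v) ⬝ᵥ u := by
    rw [star_mulVec, conjTranspose_conjTranspose, dotProduct_mulVec]
  rw [h1]
  exact (norm_star_dotProduct_le _ _).trans
    (mul_le_mul_of_nonneg_right (l2Norm_conjTranspose_mulVec_le h v) (l2Norm_nonneg u))

open scoped MatrixOrder in
-- Factor E = Bᴴ B. The bound E ≤ 1 makes B norm-nonincreasing, and Cauchy–Schwarz applies to the
-- vectors B v and B u.
lemma isContractive_of_posSemidef [DecidableEq I] {E : Matrix I I ℂ} (h0 : E.PosSemidef)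
    (h1 : (1 - E).PosSemidef) : IsContractive E := by
  obtain ⟨B, hB⟩ := CStarAlgebra.nonneg_iff_eq_star_mul_self.mp h0.nonneg
  rw [star_eq_conjTranspose] at hB
  have key : ∀ w : I → ℂ, l2Norm (B *ᵥ w) ≤ l2Norm w := by
    intro w
    have h := l2Norm_conjTranspose_mulVec_le (A := Bᴴ)
      (by rw [conjTranspose_conjTranspose, ← hB]; exact h1) w
    rwa [conjTranspose_conjTranspose] at h
  intro u v
  have h2 : star v ⬝ᵥ E *ᵥ u = star (B *ᵥ v) ⬝ᵥ (B *ᵥ u) := by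
    rw [hB, star_mulVec, ← mulVec_mulVec, dotProduct_mulVec]
  rw [h2]
  exact (norm_star_dotProduct_le _ _).trans
    (mul_le_mul (key v) (key u) (l2Norm_nonneg _) (l2Norm_nonneg _))

/-- The trace norm is attained as the trace against a contraction (polar decomposition). -/
lemma exists_isContractive_trace_eq_traceNorm [DecidableEq I] (M : Matrix I I ℂ) :
    ∃ U : Matrix I I ℂ, IsContractive U ∧ (U * M).trace = (traceNorm M : ℂ) := by
  set hH := isHermitian_conjTranspose_mul_self M with hHdef
  set V : Matrix I I ℂ := (hH.eigenvectorUnitary : Matrix I I ℂ) with hV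
  set s : I → ℝ := fun i => Real.sqrt (hH.eigenvalues i) with hs
  have hpos : ∀ i, 0 ≤ hH.eigenvalues i :=
    fun i => (posSemidef_conjTranspose_mul_self M).eigenvalues_nonneg i
  have hVV : Vᴴ * V = 1 := by
    rw [← star_eq_conjTranspose]; exact Unitary.coe_star_mul_self hH.eigenvectorUnitary
  have hVV' : V * Vᴴ = 1 := by
    rw [← star_eq_conjTranspose]; exact Unitary.coe_mul_star_self hH.eigenvectorUnitary
  have hMM : Mᴴ * M = V * diagonal (fun i => ((s i : ℂ)) ^ 2) * Vᴴ := by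
    have h := hH.spectral_theorem
    rw [Unitary.conjStarAlgAut_apply] at h
    rw [← star_eq_conjTranspose V]
    refine h.trans ?_
    congr 3
    funext i
    simp only [Function.comp, hs]
    rw [← Complex.ofReal_pow, Real.sq_sqrt (hpos i)]
    rfl
  -- Since 0⁻¹ = 0, this is the pseudo-inverse of the singular values. Hence U Uᴴ below is the
  -- projection onto the eigenvectors with nonzero singular value, even when M is singular.
  set D : Matrix I I ℂ := diagonal fun i => ((s i : ℂ))⁻¹ with hD
  have hDH : Dᴴ = D := by
    rw [hD, diagonal_conjTranspose]
    congr 1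
    funext i
    simp
  refine ⟨V * D * Vᴴ * Mᴴ, isContractive_of_posSemidef_one_sub_mul_conjTranspose ?_, ?_⟩
  · have h1 : (V * D * Vᴴ * Mᴴ) * (V * D * Vᴴ * Mᴴ)ᴴ =
        V * diagonal (fun i => if s i = 0 then (0 : ℂ) else 1) * Vᴴ := by
      simp only [conjTranspose_mul, conjTranspose_conjTranspose, hDH]
      calc V * D * Vᴴ * Mᴴ * (M * (V * (D * Vᴴ))) = V * D * Vᴴ * (Mᴴ * M) * V * D * Vᴴ := by
            simp only [Matrix.mul_assoc]
        _ = V * D * (Vᴴ * V) * diagonal (fun i => ((s i : ℂ)) ^ 2) * (Vᴴ * V) * D * Vᴴ := by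
            rw [hMM]; simp only [Matrix.mul_assoc]
        _ = V * (D * diagonal (fun i => ((s i : ℂ)) ^ 2) * D) * Vᴴ := by
            rw [hVV]; simp only [Matrix.mul_assoc, Matrix.one_mul]
        _ = _ := by
            rw [hD, diagonal_mul_diagonal, diagonal_mul_diagonal]
            congr 3
            funext i
            split_ifs with h
            · simp [h]
            · have : (s i : ℂ) ≠ 0 := by exact_mod_cast h
              field_simp
    have h2 : 1 - (V * D * Vᴴ * Mᴴ) * (V * D * Vᴴ * Mᴴ)ᴴ =
        V * diagonal (fun i => if s i = 0 then (1 : ℂ) else 0) * Vᴴ := by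
      rw [h1]
      conv_lhs => rw [← hVV', ← Matrix.mul_one V, Matrix.mul_assoc V 1, ← Matrix.mul_one V]
      simp only [Matrix.mul_one]
      rw [Matrix.mul_assoc V _ Vᴴ, Matrix.one_mul, ← Matrix.mul_sub]
      nth_rw 1 [← Matrix.one_mul Vᴴ]
      rw [← Matrix.sub_mul, ← diagonal_one, diagonal_sub, Matrix.mul_assoc]
      congr 3
      funext i
      split_ifs <;> simp
    rw [h2]
    refine PosSemidef.mul_mul_conjTranspose_same (PosSemidef.diagonal ?_) V
    intro i
    dsimp only [Pi.zero_apply]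
    split_ifs <;> simp
  · calc (V * D * Vᴴ * Mᴴ * M).trace = (V * D * (Vᴴ * V) *
          diagonal (fun i => ((s i : ℂ)) ^ 2) * Vᴴ).trace := by
          rw [Matrix.mul_assoc _ Mᴴ M, hMM]; simp only [Matrix.mul_assoc]
      _ = (D * diagonal (fun i => ((s i : ℂ)) ^ 2)).trace := by
          rw [hVV, Matrix.mul_one, trace_mul_comm, Matrix.mul_assoc V D, ← Matrix.mul_assoc, hVV,
            Matrix.one_mul]
      _ = _ := by
          rw [hD, diagonal_mul_diagonal, trace_diagonal, traceNorm, Complex.ofReal_sum]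
          refine Finset.sum_congr rfl fun i _ => ?_
          change _ = (s i : ℂ)
          by_cases h : (s i : ℂ) = 0
          · simp [h]
          · field_simp

lemma traceNorm_le_of_forall_isContractive [DecidableEq I] {M : Matrix I I ℂ} {b : ℝ}
    (h : ∀ U : Matrix I I ℂ, IsContractive U → ‖(U * M).trace‖ ≤ b) : traceNorm M ≤ b := by
  obtain ⟨U, hU, hUM⟩ := exists_isContractive_trace_eq_traceNorm M
  have h1 := h U hU
  rw [hUM, Complex.norm_real] at h1
  exact (le_abs_self _).trans h1

lemma norm_trace_mul_vecMulVec_le {U : Matrix I I ℂ} (hU : IsContractive U) (u v : I → ℂ) :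
    ‖(U * vecMulVec u (star v)).trace‖ ≤ l2Norm v * l2Norm u := by
  rw [mul_vecMulVec, trace_vecMulVec, dotProduct_comm]
  exact hU u v

lemma l2Norm_ite_le (P : I → Prop) [DecidablePred P] (ψ : I → ℂ) :
    l2Norm (fun i => if P i then ψ i else 0) ≤ l2Norm ψ := by
  refine le_of_sq_le_sq ?_ (l2Norm_nonneg _)
  rw [l2Norm_sq, l2Norm_sq]
  refine Finset.sum_le_sum fun i _ => ?_
  split_ifs
  · exact le_rfl
  · simp

/-- Restricting a unit vector to a coordinate subspace moves its state by at most twice the norm of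
the removed part. -/
lemma norm_trace_mul_ketBra_sub_le [DecidableEq I] {U : Matrix I I ℂ} (hU : IsContractive U)
    (P : I → Prop) [DecidablePred P] {ψ : I → ℂ} (hψ : l2Norm ψ = 1) :
    ‖(U * (ketBra ψ - diagonal (fun i => if P i then (1 : ℂ) else 0) * ketBra ψ *
      diagonal (fun i => if P i then (1 : ℂ) else 0))).trace‖ ≤
      2 * l2Norm (fun i => if P i then 0 else ψ i) := by
  set φ : I → ℂ := fun i => if P i then ψ i else 0 with hφ
  set χ : I → ℂ := fun i => if P i then 0 else ψ i with hχ
  -- With ψ = φ + χ, telescope: ψψ* - φφ* = χψ* + φχ*. Each term contains χ once, next to a vector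
  -- of norm at most one.
  have hsplit : ketBra ψ - diagonal (fun i => if P i then (1 : ℂ) else 0) * ketBra ψ *
      diagonal (fun i => if P i then (1 : ℂ) else 0) =
      vecMulVec χ (star ψ) + vecMulVec φ (star χ) := by
    ext i j
    simp only [ketBra, Matrix.sub_apply, Matrix.add_apply, mul_diagonal, diagonal_mul, vecMulVec_apply,
      Pi.star_apply, hφ, hχ]
    split_ifs <;> simp
  rw [hsplit, Matrix.mul_add, trace_add]
  have hφ1 : l2Norm φ ≤ 1 := hψ ▸ l2Norm_ite_le P ψ
  have h1 := norm_trace_mul_vecMulVec_le hU χ ψ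
  have h2 := norm_trace_mul_vecMulVec_le hU φ χ
  rw [hψ] at h1
  have h3 : l2Norm χ * l2Norm φ ≤ l2Norm χ := mul_le_of_le_one_right (l2Norm_nonneg _) hφ1
  refine (norm_add_le _ _).trans ?_
  linarith

end Contractive

/-! ### Copies of function states -/

section Copies

variable {X : Type} [Fintype X]

/-- The coordinate vector of `t` copies of the function state. -/
noncomputable def copyVec (f : X → Bool) (t : ℕ) : Register X t → ℂ :=
  fun r => ∏ j, functionState f (r j)

lemma copies_eq_ketBra (f : X → Bool) (t : ℕ) : copies f t = ketBra (copyVec f t) := by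
  ext r s
  simp [copies, tensorPower, ketBra, copyVec, vecMulVec_apply, Finset.prod_mul_distrib]

/-- Amplitudes are real, so conjugation disappears and an entry is a scalar independent of f times
0/1 tests on f, ready for averaging. -/
lemma copies_apply (f : X → Bool) (t : ℕ) (r s : Register X t) :
    copies f t r s = (((1 / Real.sqrt (Fintype.card X) : ℝ) : ℂ) ^ 2) ^ t *
      ((∏ j, if f (r j).1 = (r j).2 then 1 else 0) *
        ∏ j, if f (s j).1 = (s j).2 then 1 else 0) := by
  have h : ∀ r : Register X t, ∏ j, functionState f (r j) =
      ((1 / Real.sqrt (Fintype.card X) : ℝ) : ℂ) ^ t *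
        ∏ j, if f (r j).1 = (r j).2 then 1 else 0 := by
    intro r
    rw [← Fin.prod_const, ← Finset.prod_mul_distrib]
    refine Finset.prod_congr rfl fun j _ => ?_
    simp [functionState]
  have h' : star (copyVec f t s) = copyVec f t s := by
    rw [copyVec, h]
    simp only [star_mul', star_pow, star_prod, apply_ite star, star_one, star_zero,
      RCLike.star_def, Complex.conj_ofReal]
  rw [copies_eq_ketBra, ketBra, vecMulVec_apply, Pi.star_apply, h', copyVec, copyVec, h, h]
  ring

variable [Nonempty X]

/-- Measuring the copies yields uniform independent inputs: the vector is supported on labels (z, f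
z), each of weight |X|^{-t}. Norms thus become counts of input tuples. -/
lemma sum_norm_sq_copyVec (f : X → Bool) (t : ℕ) (P : (Fin t → X) → Prop) [DecidablePred P] :
    ∑ r : Register X t, (if P (fun j => (r j).1) then ‖copyVec f t r‖ ^ 2 else 0) =
      ((Finset.univ.filter P).card : ℝ) / (Fintype.card X : ℝ) ^ t := by
  classical
  have hN : (0 : ℝ) < Fintype.card X := by exact_mod_cast Fintype.card_pos
  have h : ∑ z : Fin t → X, (if P z then (1 / (Fintype.card X : ℝ) ^ t) else 0) =
      ∑ r : Register X t, (if P (fun j => (r j).1) then ‖copyVec f t r‖ ^ 2 else 0) := by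
    refine Finset.sum_of_injOn (fun z j => (z j, f (z j))) ?_ (by simp) ?_ ?_
    · intro z _ z' _ hzz
      funext j
      exact congrArg Prod.fst (congrFun hzz j)
    · intro r _ hr
      have : ∃ j, f (r j).1 ≠ (r j).2 := by
        by_contra! hcon
        exact hr ⟨fun j => (r j).1, by simp, funext fun j => Prod.ext rfl (hcon j)⟩
      obtain ⟨j, hj⟩ := this
      have h0 : copyVec f t r = 0 :=
        Finset.prod_eq_zero (Finset.mem_univ j) (by simp [functionState, hj])
      simp [h0]
    · intro z _
      have : ‖copyVec f t (fun j => (z j, f (z j)))‖ ^ 2 = 1 / (Fintype.card X : ℝ) ^ t := by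
        simp only [copyVec, functionState, if_true, Finset.prod_const, Finset.card_univ,
          Fintype.card_fin, norm_pow, Complex.norm_real, Real.norm_eq_abs]
        rw [← pow_mul, mul_comm t 2, pow_mul, sq_abs, div_pow, Real.sq_sqrt hN.le]
        simp
      simp [this]
  rw [← h, ← Finset.sum_filter, Finset.sum_const, nsmul_eq_mul, mul_one_div]

lemma l2Norm_copyVec (f : X → Bool) (t : ℕ) : l2Norm (copyVec f t) = 1 := by
  have hN : (0 : ℝ) < Fintype.card X := by exact_mod_cast Fintype.card_pos
  have h := sum_norm_sq_copyVec f t (fun _ => True)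
  simp only [if_true, Finset.filter_true, Finset.card_univ, Fintype.card_pi, Finset.prod_const,
    Fintype.card_fin, Nat.cast_pow] at h
  rw [div_self (by positivity), ← l2Norm_sq] at h
  exact (pow_eq_one_iff_of_nonneg (l2Norm_nonneg _) two_ne_zero).mp h

lemma trace_copies (f : X → Bool) (t : ℕ) : (copies f t).trace = 1 := by
  rw [copies_eq_ketBra, ketBra, trace_vecMulVec, dotProduct_comm, star_dotProduct_self,
    l2Norm_copyVec]
  simp

end Copies

/-! ### Collisions -/

/-- Overwriting the first component at position j by an arbitrary c is injective on colliding
tuples, because the lost value is still present at position i. -/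
lemma card_coordinate_collision_mul_le {Y Z : Type} [Fintype Y] [DecidableEq Y] [Fintype Z]
    [DecidableEq Z] {t : ℕ} {i j : Fin t} (hij : i ≠ j) :
    (Finset.univ.filter fun z : Fin t → Y × Z => (z i).1 = (z j).1).card * Fintype.card Y ≤
      Fintype.card (Y × Z) ^ t := by
  have h : Fintype.card (Y × Z) ^ t = (Finset.univ : Finset (Fin t → Y × Z)).card := by
    simp
  rw [h, ← Finset.card_univ (α := Y), ← Finset.card_product]
  refine Finset.card_le_card_of_injOn
    (fun p => Function.update p.1 j (p.2, (p.1 j).2)) (by simp) ?_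
  rintro ⟨z, c⟩ hz ⟨z', c'⟩ hz' heq
  simp only [Finset.coe_product, Finset.coe_filter, Finset.mem_univ, true_and, Finset.coe_univ,
    Set.mem_prod, Set.mem_ofPred_eq, Set.mem_univ, and_true] at hz hz'
  dsimp only at heq
  have hj := congrFun heq j
  simp only [Function.update_self, Prod.mk.injEq] at hj
  have hne : ∀ k, k ≠ j → z k = z' k := by
    intro k hk
    have := congrFun heq k
    rwa [Function.update_of_ne hk, Function.update_of_ne hk] at this
  refine Prod.ext (funext fun k => ?_) hj.1
  by_cases hk : k = j
  · subst hk
    refine Prod.ext ?_ hj.2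
    rw [← hz, ← hz', hne i hij]
  · exact hne k hk

/-- Union bound over ordered pairs of positions, crudely counted as t². -/
lemma card_not_injective_mul_le {Y Z : Type} [Fintype Y] [DecidableEq Y] [Fintype Z]
    [DecidableEq Z] (t : ℕ) :
    (Finset.univ.filter fun z : Fin t → Y × Z =>
      ¬ Function.Injective fun j => (z j).1).card * Fintype.card Y ≤
      t ^ 2 * Fintype.card (Y × Z) ^ t := by
  have hsub : (Finset.univ.filter fun z : Fin t → Y × Z =>
      ¬ Function.Injective fun j => (z j).1) ⊆
      (Finset.univ.filter fun p : Fin t × Fin t => p.1 ≠ p.2).biUnion fun p =>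
        Finset.univ.filter fun z : Fin t → Y × Z => (z p.1).1 = (z p.2).1 := by
    intro z hz
    obtain ⟨i, j, h, hne⟩ := Function.not_injective_iff.mp (Finset.mem_filter.mp hz).2
    simp only [Finset.mem_biUnion, Finset.mem_filter, Finset.mem_univ, true_and]
    exact ⟨(i, j), hne, h⟩
  calc _ ≤ (∑ p ∈ Finset.univ.filter fun p : Fin t × Fin t => p.1 ≠ p.2,
        (Finset.univ.filter fun z : Fin t → Y × Z => (z p.1).1 = (z p.2).1).card) *
          Fintype.card Y :=
        Nat.mul_le_mul_right _ ((Finset.card_le_card hsub).trans Finset.card_biUnion_le)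
    _ ≤ ∑ p ∈ Finset.univ.filter fun p : Fin t × Fin t => p.1 ≠ p.2,
        Fintype.card (Y × Z) ^ t := by
        rw [Finset.sum_mul]
        exact Finset.sum_le_sum fun p hp =>
          card_coordinate_collision_mul_le (Finset.mem_filter.mp hp).2
    _ ≤ _ := by
        rw [Finset.sum_const, smul_eq_mul]
        refine Nat.mul_le_mul_right _ ((Finset.card_filter_le _ _).trans ?_)
        simp [sq]

lemma l2Norm_copyVec_collision_le {n : ℕ} (f : Input n → Bool) (t : ℕ) :
    l2Norm (fun r => if Function.Injective (fun j => (r j).1.1) then 0 else copyVec f t r) ≤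
      (t : ℝ) / (2 : ℝ) ^ ((n : ℝ) / 2) := by
  have hpow : ((2 : ℝ) ^ ((n : ℝ) / 2)) ^ 2 = 2 ^ n := by
    rw [← Real.rpow_natCast, ← Real.rpow_mul (by norm_num)]
    norm_num
  refine le_of_sq_le_sq ?_ (by positivity)
  have h := sum_norm_sq_copyVec f t (fun z => ¬ Function.Injective fun j => (z j).1)
  have hl : l2Norm (fun r => if Function.Injective (fun j => (r j).1.1) then 0
      else copyVec f t r) ^ 2 = ∑ r : Register (Input n) t,
        (if ¬ Function.Injective (fun j => (r j).1.1) then ‖copyVec f t r‖ ^ 2 else 0) := by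
    rw [l2Norm_sq]
    refine Finset.sum_congr rfl fun r _ => ?_
    split_ifs <;> simp_all
  rw [hl, h, div_pow, hpow]
  have hN : (0 : ℝ) < Fintype.card (Input n) := by exact_mod_cast Fintype.card_pos
  have hc := card_not_injective_mul_le (Y := Cube n) (Z := Bool × Bool) t
  have hY : Fintype.card (Cube n) = 2 ^ n := by simp
  rw [hY] at hc
  rw [div_le_div_iff₀ (by positivity) (by positivity)]
  exact_mod_cast hc

/-! ### Set triples as bit-valued functions -/

/-- The value at address `a` of the table `(v₀₀, v₀₁, v₁₀)`, with value `0` at address `11`. -/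
def bitAt (v : Bool × Bool × Bool) : Bool × Bool → Bool
  | (false, false) => v.1
  | (false, true) => v.2.1
  | (true, false) => v.2.2
  | (true, true) => false

/-- The function `(x, a) ↦ (g x)_a`. -/
def bitFun {n : ℕ} (g : Cube n → Bool × Bool × Bool) (p : Input n) : Bool := bitAt (g p.1) p.2

/-- Appends the parity of two bits. -/
def withParity (w : Bool × Bool) : Bool × Bool × Bool := (w.1, w.2, xor w.1 w.2)

lemma tripleFun_eq_bitFun {n : ℕ} (A B C : Finset (Cube n)) :
    tripleFun A B C = bitFun fun x => (decide (x ∈ A), decide (x ∈ B), decide (x ∈ C)) := by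
  funext ⟨x, a, b⟩
  cases a <;> cases b <;> rfl

lemma tripleFun_symmDiff_eq_bitFun {n : ℕ} (A B : Finset (Cube n)) :
    tripleFun A B (symmDiff A B) =
      bitFun fun x => withParity (decide (x ∈ A), decide (x ∈ B)) := by
  rw [tripleFun_eq_bitFun]
  congr 1
  funext x
  by_cases hA : x ∈ A <;> by_cases hB : x ∈ B <;>
    simp [withParity, Finset.mem_symmDiff, hA, hB]

section Equivs

variable (α : Type) [Fintype α] [DecidableEq α]

/-- Pairs of subsets as functions into pairs of bits. -/
def pairEquiv : Finset α × Finset α ≃ (α → Bool × Bool) where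
  toFun S x := (decide (x ∈ S.1), decide (x ∈ S.2))
  invFun g := (Finset.univ.filter fun x => (g x).1 = true,
    Finset.univ.filter fun x => (g x).2 = true)
  left_inv S := by simp
  right_inv g := by simp

/-- Triples of subsets as functions into triples of bits. -/
def tripleEquiv : Finset α × Finset α × Finset α ≃ (α → Bool × Bool × Bool) where
  toFun S x := (decide (x ∈ S.1), decide (x ∈ S.2.1), decide (x ∈ S.2.2))
  invFun g := (Finset.univ.filter fun x => (g x).1 = true,
    Finset.univ.filter fun x => (g x).2.1 = true, Finset.univ.filter fun x => (g x).2.2 = true)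
  left_inv S := by simp
  right_inv g := by simp

end Equivs

lemma ensembleZero_eq (n t : ℕ) : ensembleZero n t =
    (Fintype.card (Cube n → Bool × Bool × Bool) : ℂ)⁻¹ • ∑ g, copies (bitFun g) t := by
  have hc : (Fintype.card (Cube n → Bool × Bool × Bool) : ℂ) =
      (Fintype.card (Finset (Cube n)) : ℂ) ^ 3 := by
    rw [← Fintype.card_congr (tripleEquiv (Cube n)), Fintype.card_prod, Fintype.card_prod]
    push_cast; ring
  rw [ensembleZero, hc, ← (tripleEquiv (Cube n)).sum_comp, Fintype.sum_prod_type]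
  simp only [Fintype.sum_prod_type, tripleFun_eq_bitFun]
  rfl

lemma ensembleOne_eq (n t : ℕ) : ensembleOne n t =
    (Fintype.card (Cube n → Bool × Bool) : ℂ)⁻¹ •
      ∑ g : Cube n → Bool × Bool, copies (bitFun fun x => withParity (g x)) t := by
  have hc : (Fintype.card (Cube n → Bool × Bool) : ℂ) =
      (Fintype.card (Finset (Cube n)) : ℂ) ^ 2 := by
    rw [← Fintype.card_congr (pairEquiv (Cube n)), Fintype.card_prod]
    push_cast; ring
  rw [ensembleOne, hc, ← (pairEquiv (Cube n)).sum_comp, Fintype.sum_prod_type]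
  simp only [tripleFun_symmDiff_eq_bitFun]
  rfl

/-! ### Agreement on the distinct-input subspace -/

/-- Indicator that a table passes an optional test of one of its values. -/
def tableTest : Option ((Bool × Bool) × Bool) → Bool × Bool × Bool → ℕ
  | none, _ => 1
  | some c, v => if bitAt v c.1 = c.2 then 1 else 0

/-- The values of `(u, v, u ⊕ v)` are pairwise independent and uniform. -/
lemma sum_tableTest_mul : ∀ c d : Option ((Bool × Bool) × Bool),
    ∑ v, tableTest c v * tableTest d v =
      2 * ∑ w, tableTest c (withParity w) * tableTest d (withParity w) := by
  decide

/-- Distinct strings mean that each point carries at most one test, so the product over copies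
regroups as a product over all points. Unvisited points get `none`, which contributes the factor 1.
-/
lemma exists_prod_eq_prod_tableTest {n t : ℕ} (r : Register (Input n) t)
    (hr : Function.Injective fun j => (r j).1.1) :
    ∃ c : Cube n → Option ((Bool × Bool) × Bool), ∀ g : Cube n → Bool × Bool × Bool,
      (∏ j, if bitFun g (r j).1 = (r j).2 then (1 : ℂ) else 0) =
        ((∏ x, tableTest (c x) (g x) : ℕ) : ℂ) := by
  classical
  refine ⟨fun x => if h : ∃ j, (r j).1.1 = x then
    some ((r h.choose).1.2, (r h.choose).2) else none, fun g => ?_⟩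
  rw [Nat.cast_prod]
  refine Finset.prod_of_injOn (fun j => (r j).1.1) hr.injOn (by simp) ?_ ?_
  · intro x _ hx
    have : ¬ ∃ j, (r j).1.1 = x := by
      rintro ⟨j, hj⟩
      exact hx ⟨j, by simp, hj⟩
    simp [this, tableTest]
  · intro j _
    have h : ∃ k, (r k).1.1 = (r j).1.1 := ⟨j, rfl⟩
    have hj : h.choose = j := hr h.choose_spec
    simp only [dif_pos h, hj, tableTest, bitFun]
    push_cast
    rfl

/-- Both sums over g factor over points. Pairwise independence gives a factor 2 per point, which is
exactly the ratio of the two normalizations. -/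
lemma ensembleZero_apply_eq_ensembleOne_apply {n t : ℕ} {r s : Register (Input n) t}
    (hr : Function.Injective fun j => (r j).1.1) (hs : Function.Injective fun j => (s j).1.1) :
    ensembleZero n t r s = ensembleOne n t r s := by
  obtain ⟨c, hc⟩ := exists_prod_eq_prod_tableTest r hr
  obtain ⟨d, hd⟩ := exists_prod_eq_prod_tableTest s hs
  rw [ensembleZero_eq, ensembleOne_eq]
  simp only [Matrix.smul_apply, Matrix.sum_apply, copies_apply, hc, hd, ← Finset.mul_sum,
    ← Nat.cast_mul, ← Finset.prod_mul_distrib, ← Nat.cast_sum]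
  rw [← Fintype.prod_sum fun x v => tableTest (c x) v * tableTest (d x) v,
    ← Fintype.prod_sum fun x w =>
      tableTest (c x) (withParity w) * tableTest (d x) (withParity w),
    Finset.prod_congr rfl fun x _ => sum_tableTest_mul (c x) (d x), Finset.prod_mul_distrib]
  have h8 : (Fintype.card (Cube n → Bool × Bool × Bool) : ℂ) =
      (∏ _x : Cube n, 2 : ℕ) * (Fintype.card (Cube n → Bool × Bool) : ℂ) := by
    norm_cast
    simp only [Fintype.card_pi, Fintype.card_prod, Fintype.card_bool, ← Finset.prod_mul_distrib]
  rw [h8, smul_eq_mul, smul_eq_mul, Nat.cast_mul]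
  have h2 : ((∏ _x : Cube n, 2 : ℕ) : ℂ) ≠ 0 := by simp
  have h4 : (Fintype.card (Cube n → Bool × Bool) : ℂ) ≠ 0 := by
    exact_mod_cast Fintype.card_ne_zero
  field_simp

lemma distinctProj_mul_mul_apply {n t : ℕ}
    (M : Matrix (Register (Input n) t) (Register (Input n) t) ℂ) (r s : Register (Input n) t) :
    (distinctProj n t * M * distinctProj n t) r s =
      (if Function.Injective (fun j => (r j).1.1) then 1 else 0) * M r s *
        (if Function.Injective (fun j => (s j).1.1) then 1 else 0) := by
  rw [distinctProj, mul_diagonal, diagonal_mul]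

lemma distinctProj_mul_ensembleZero_mul_eq (n t : ℕ) :
    distinctProj n t * ensembleZero n t * distinctProj n t =
      distinctProj n t * ensembleOne n t * distinctProj n t := by
  ext r s
  rw [distinctProj_mul_mul_apply, distinctProj_mul_mul_apply]
  by_cases hr : Function.Injective fun j => (r j).1.1
  · by_cases hs : Function.Injective fun j => (s j).1.1
    · rw [ensembleZero_apply_eq_ensembleOne_apply hr hs]
    · rw [if_neg hs, mul_zero, mul_zero]
  · rw [if_neg hr, zero_mul, zero_mul, zero_mul, zero_mul]

/-! ### Trace distance estimates -/

/-- The bound holds for each function separately, so it survives averaging by the triangle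
inequality. -/
lemma norm_trace_mul_average_sub_le {n t : ℕ} {ι : Type} [Fintype ι] [Nonempty ι]
    (F : ι → Input n → Bool) {E : Matrix (Register (Input n) t) (Register (Input n) t) ℂ}
    (hE : E = (Fintype.card ι : ℂ)⁻¹ • ∑ g, copies (F g) t)
    {U : Matrix (Register (Input n) t) (Register (Input n) t) ℂ} (hU : IsContractive U) :
    ‖(U * (E - distinctProj n t * E * distinctProj n t)).trace‖ ≤
      2 * ((t : ℝ) / (2 : ℝ) ^ ((n : ℝ) / 2)) := by
  have hN : (0 : ℝ) < Fintype.card ι := by exact_mod_cast Fintype.card_pos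
  have h1 : E - distinctProj n t * E * distinctProj n t = (Fintype.card ι : ℂ)⁻¹ •
      ∑ g, (copies (F g) t - distinctProj n t * copies (F g) t * distinctProj n t) := by
    rw [hE, Finset.sum_sub_distrib, smul_sub, Matrix.mul_smul, Matrix.smul_mul,
      Matrix.mul_sum, Matrix.sum_mul]
  have h2 : ∀ g, ‖(U * (copies (F g) t -
      distinctProj n t * copies (F g) t * distinctProj n t)).trace‖ ≤
      2 * ((t : ℝ) / (2 : ℝ) ^ ((n : ℝ) / 2)) := by
    intro g
    rw [copies_eq_ketBra, distinctProj]
    refine (norm_trace_mul_ketBra_sub_le hU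
      (fun r : Register (Input n) t => Function.Injective fun j => (r j).1.1)
      (l2Norm_copyVec (F g) t)).trans ?_
    exact mul_le_mul_of_nonneg_left (l2Norm_copyVec_collision_le (F g) t) (by norm_num)
  rw [h1, Matrix.mul_smul, trace_smul, Matrix.mul_sum, trace_sum, norm_smul, norm_inv,
    Complex.norm_natCast, inv_mul_le_iff₀ hN]
  refine (norm_sum_le _ _).trans ((Finset.sum_le_sum fun g _ => h2 g).trans ?_)
  rw [Finset.sum_const, Finset.card_univ, nsmul_eq_mul]

lemma norm_trace_mul_ensembleZero_sub_le {n t : ℕ}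
    {U : Matrix (Register (Input n) t) (Register (Input n) t) ℂ} (hU : IsContractive U) :
    ‖(U * (ensembleZero n t -
      distinctProj n t * ensembleZero n t * distinctProj n t)).trace‖ ≤
      2 * ((t : ℝ) / (2 : ℝ) ^ ((n : ℝ) / 2)) :=
  norm_trace_mul_average_sub_le _ (ensembleZero_eq n t) hU

lemma norm_trace_mul_ensembleOne_sub_le {n t : ℕ}
    {U : Matrix (Register (Input n) t) (Register (Input n) t) ℂ} (hU : IsContractive U) :
    ‖(U * (ensembleOne n t -
      distinctProj n t * ensembleOne n t * distinctProj n t)).trace‖ ≤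
      2 * ((t : ℝ) / (2 : ℝ) ^ ((n : ℝ) / 2)) :=
  norm_trace_mul_average_sub_le _ (ensembleOne_eq n t) hU

lemma norm_trace_mul_ensemble_diff_le {n t : ℕ}
    {U : Matrix (Register (Input n) t) (Register (Input n) t) ℂ} (hU : IsContractive U) :
    ‖(U * (ensembleZero n t - ensembleOne n t)).trace‖ ≤
      4 * ((t : ℝ) / (2 : ℝ) ^ ((n : ℝ) / 2)) := by
  have h : ensembleZero n t - ensembleOne n t =
      (ensembleZero n t - distinctProj n t * ensembleZero n t * distinctProj n t) -
      (ensembleOne n t - distinctProj n t * ensembleOne n t * distinctProj n t) := by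
    rw [distinctProj_mul_ensembleZero_mul_eq]; abel
  rw [h, Matrix.mul_sub, trace_sub]
  refine (norm_sub_le _ _).trans ?_
  have h0 := norm_trace_mul_ensembleZero_sub_le hU
  have h1 := norm_trace_mul_ensembleOne_sub_le hU
  linarith

/-! ### The passive lower bound -/

section Chebyshev

variable {α β : Type} [Fintype α] [DecidableEq α] [Fintype β]

lemma sum_pi_mul_eq_zero {Y : β → ℝ} (hY : ∑ v, Y v = 0) {x y : α} (hxy : x ≠ y) :
    ∑ g : α → β, Y (g x) * Y (g y) = 0 := by
  -- Padding with ones gives a product over all coordinates, so the sum over g factors. The factor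
  -- at x is ∑ Y = 0.
  have h : ∀ g : α → β, Y (g x) * Y (g y) =
      ∏ z, ((if z = x then Y (g z) else 1) * (if z = y then Y (g z) else 1)) := by
    intro g
    rw [Finset.prod_mul_distrib, Finset.prod_ite_eq', Finset.prod_ite_eq']
    simp
  simp only [h]
  rw [← Fintype.prod_sum fun z v => (if z = x then Y v else 1) * (if z = y then Y v else 1)]
  refine Finset.prod_eq_zero (Finset.mem_univ x) ?_
  simpa [hxy] using hY

/-- Variance of a sum of independent centred variables: only the diagonal terms survive. -/
lemma sum_pi_sq_le {Y : β → ℝ} (hY : ∑ v, Y v = 0) (hb : ∀ v, |Y v| ≤ 1) :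
    ∑ g : α → β, (∑ x, Y (g x)) ^ 2 ≤ Fintype.card α * Fintype.card (α → β) := by
  have h : ∀ g : α → β, (∑ x, Y (g x)) ^ 2 = ∑ x, ∑ y, Y (g x) * Y (g y) := by
    intro g
    rw [sq, Finset.sum_mul_sum]
  simp only [h]
  rw [Finset.sum_comm]
  have h2 : ∀ x : α, ∑ g : α → β, ∑ y, Y (g x) * Y (g y) ≤ Fintype.card (α → β) := by
    intro x
    rw [Finset.sum_comm, Finset.sum_eq_single x (fun y _ hy => sum_pi_mul_eq_zero hY hy.symm)
      (by simp)]
    calc ∑ g : α → β, Y (g x) * Y (g x) ≤ ∑ _g : α → β, (1 : ℝ) := by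
          refine Finset.sum_le_sum fun g _ => ?_
          rw [← sq, ← sq_abs]
          exact pow_le_one₀ (abs_nonneg _) (hb _)
      _ = _ := by simp
  refine (Finset.sum_le_sum fun x _ => h2 x).trans ?_
  simp

end Chebyshev

/-- The points of the triple intersection described by `g`. -/
def fullPoints {n : ℕ} (g : Cube n → Bool × Bool × Bool) : Finset (Cube n) :=
  Finset.univ.filter fun x => g x = (true, true, true)

lemma bitFun_mem_familyZero {n : ℕ} {g : Cube n → Bool × Bool × Bool}
    (hg : (1 / 16 : ℝ) ≤ ((fullPoints g).card : ℝ) / 2 ^ n) : bitFun g ∈ familyZero n := by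
  obtain ⟨⟨A, B, C⟩, rfl⟩ := (tripleEquiv (Cube n)).surjective g
  refine ⟨A, B, C, ?_, ?_⟩
  · have h : fullPoints (tripleEquiv (Cube n) (A, B, C)) = A ∩ B ∩ C := by
      ext x
      simp [fullPoints, tripleEquiv]
    rwa [← h]
  · rw [tripleFun_eq_bitFun]; rfl

lemma bitFun_withParity_mem_familyOne {n : ℕ} (g : Cube n → Bool × Bool) :
    (bitFun fun x => withParity (g x)) ∈ familyOne n := by
  obtain ⟨⟨A, B⟩, rfl⟩ := (pairEquiv (Cube n)).surjective g
  exact ⟨A, B, (tripleFun_symmDiff_eq_bitFun A B).symm⟩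

/-- All but a `256 / 2^n` fraction of triples have a triple intersection of density `1/16`. -/
lemma card_sparse_mul_le (n : ℕ) :
    ((Finset.univ.filter fun g : Cube n → Bool × Bool × Bool =>
      ¬ (1 / 16 : ℝ) ≤ ((fullPoints g).card : ℝ) / 2 ^ n).card : ℝ) * 2 ^ n ≤
      256 * Fintype.card (Cube n → Bool × Bool × Bool) := by
  set Y : Bool × Bool × Bool → ℝ :=
    fun v => (if v = (true, true, true) then 1 else 0) - 1 / 8 with hYdef
  have hY : ∑ v, Y v = 0 := by
    simp [hYdef, Finset.sum_sub_distrib]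
  have hb : ∀ v, |Y v| ≤ 1 := by
    intro v
    simp only [hYdef]
    split_ifs <;> norm_num [abs_le]
  have hN : (0 : ℝ) < 2 ^ n := by positivity
  have hsum : ∀ g : Cube n → Bool × Bool × Bool,
      ∑ x, Y (g x) = ((fullPoints g).card : ℝ) - 2 ^ n / 8 := by
    intro g
    simp only [hYdef, Finset.sum_sub_distrib, Finset.sum_boole, fullPoints, Finset.sum_const,
      Finset.card_univ, nsmul_eq_mul]
    simp
    ring
  have h := sum_pi_sq_le (α := Cube n) hY hb
  have hcard : (Fintype.card (Cube n) : ℝ) = 2 ^ n := by simp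
  rw [hcard] at h
  -- The mean density is 1/8, so a sparse g deviates from the mean count by more than 2^n/16.
  -- Squaring gives the 256.
  have hlow : ((Finset.univ.filter fun g : Cube n → Bool × Bool × Bool =>
      ¬ (1 / 16 : ℝ) ≤ ((fullPoints g).card : ℝ) / 2 ^ n).card : ℝ) * ((2 ^ n) ^ 2 / 256) ≤
      ∑ g : Cube n → Bool × Bool × Bool, (∑ x, Y (g x)) ^ 2 := by
    rw [← nsmul_eq_mul, ← Finset.sum_const]
    refine (Finset.sum_le_sum fun g hg => ?_).trans
      (Finset.sum_le_univ_sum_of_nonneg fun g => sq_nonneg _)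
    have hg' := (Finset.mem_filter.mp hg).2
    rw [not_le, div_lt_iff₀ hN] at hg'
    rw [hsum]
    nlinarith
  have h3 := hlow.trans h
  refine le_of_mul_le_mul_right ?_ hN
  linarith

section Tester

variable {X : Type} [Fintype X] [DecidableEq X] {t : ℕ}

lemma PassiveQuantumTester.prob_nonneg (M : PassiveQuantumTester X t) (f : X → Bool) (b : Bool) :
    0 ≤ M.prob f b := by
  have h := (M.posSemidef b).dotProduct_mulVec_nonneg (copyVec f t)
  rw [PassiveQuantumTester.prob, copies_eq_ketBra, ketBra, mul_vecMulVec, trace_vecMulVec,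
    dotProduct_comm]
  exact (Complex.nonneg_iff.mp h).1

lemma PassiveQuantumTester.effect_add_effect (M : PassiveQuantumTester X t) :
    M.effect false + M.effect true = 1 := by
  rw [← M.sum_eq_one, Fintype.sum_bool, add_comm]

lemma PassiveQuantumTester.prob_add_prob [Nonempty X] (M : PassiveQuantumTester X t)
    (f : X → Bool) : M.prob f false + M.prob f true = 1 := by
  rw [PassiveQuantumTester.prob, PassiveQuantumTester.prob, ← Complex.add_re, ← trace_add,
    ← Matrix.add_mul, M.effect_add_effect, Matrix.one_mul, trace_copies, Complex.one_re]

lemma PassiveQuantumTester.isContractive_effect_false (M : PassiveQuantumTester X t) :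
    IsContractive (M.effect false) := by
  refine isContractive_of_posSemidef (M.posSemidef false) ?_
  rw [← M.effect_add_effect, add_sub_cancel_left]
  exact M.posSemidef true

lemma PassiveQuantumTester.re_trace_average (M : PassiveQuantumTester X t) {ι : Type} [Fintype ι]
    (F : ι → X → Bool) (b : Bool) :
    (M.effect b * ((Fintype.card ι : ℂ)⁻¹ • ∑ g, copies (F g) t)).trace.re =
      (Fintype.card ι : ℝ)⁻¹ * ∑ g, M.prob (F g) b := by
  rw [Matrix.mul_smul, trace_smul, Matrix.mul_sum, trace_sum, smul_eq_mul,
    ← Complex.ofReal_natCast, ← Complex.ofReal_inv, Complex.re_ofReal_mul, Complex.re_sum]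
  rfl

end Tester

lemma re_trace_effect_mul_ensembleZero_ge {n t : ℕ} (M : PassiveQuantumTester (Input n) t)
    (hM : M.Distinguishes (familyZero n) (familyOne n) (2 / 3)) :
    2 / 3 * (1 - 256 / 2 ^ n) ≤ (M.effect false * ensembleZero n t).trace.re := by
  have hN : (0 : ℝ) < Fintype.card (Cube n → Bool × Bool × Bool) := by
    exact_mod_cast Fintype.card_pos
  have hbad := card_sparse_mul_le n
  rw [ensembleZero_eq, M.re_trace_average, ← div_eq_inv_mul, le_div_iff₀ hN]
  have hpt : ∀ g : Cube n → Bool × Bool × Bool,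
      2 / 3 - 2 / 3 * (if ¬ (1 / 16 : ℝ) ≤ ((fullPoints g).card : ℝ) / 2 ^ n then 1 else 0) ≤
        M.prob (bitFun g) false := by
    intro g
    split_ifs with h
    · linarith [hM.1 _ (bitFun_mem_familyZero h)]
    · linarith [M.prob_nonneg (bitFun g) false]
  refine le_trans ?_ (Finset.sum_le_sum fun g _ => hpt g)
  rw [Finset.sum_sub_distrib, ← Finset.mul_sum, Finset.sum_boole, Finset.sum_const,
    Finset.card_univ, nsmul_eq_mul]
  rw [← le_div_iff₀ (by positivity : (0 : ℝ) < 2 ^ n)] at hbad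
  have : 256 * (Fintype.card (Cube n → Bool × Bool × Bool) : ℝ) / 2 ^ n =
    256 / 2 ^ n * Fintype.card (Cube n → Bool × Bool × Bool) := by ring
  rw [this] at hbad
  linarith

lemma re_trace_effect_mul_ensembleOne_le {n t : ℕ} (M : PassiveQuantumTester (Input n) t)
    (hM : M.Distinguishes (familyZero n) (familyOne n) (2 / 3)) :
    (M.effect false * ensembleOne n t).trace.re ≤ 1 / 3 := by
  have hN : (0 : ℝ) < Fintype.card (Cube n → Bool × Bool) := by
    exact_mod_cast Fintype.card_pos
  rw [ensembleOne_eq, M.re_trace_average, inv_mul_le_iff₀ hN]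
  have hpt : ∀ g : Cube n → Bool × Bool,
      M.prob (bitFun fun x => withParity (g x)) false ≤ 1 / 3 := by
    intro g
    have h1 := hM.2 _ (bitFun_withParity_mem_familyOne g)
    have h2 := M.prob_add_prob (bitFun fun x => withParity (g x))
    linarith
  refine (Finset.sum_le_sum fun g _ => hpt g).trans ?_
  simp

lemma familyZero_nonempty (n : ℕ) : (familyZero n).Nonempty :=
  ⟨_, Finset.univ, Finset.univ, Finset.univ, by simp; norm_num, rfl⟩

lemma familyOne_nonempty (n : ℕ) : (familyOne n).Nonempty := ⟨_, ∅, ∅, rfl⟩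

/-- The zeroth tensor power does not depend on f, so no measurement separates anything. This settles
small n in the lower bound. -/
lemma PassiveQuantumTester.Distinguishes.pos_copies {n t : ℕ}
    {M : PassiveQuantumTester (Input n) t}
    (hM : M.Distinguishes (familyZero n) (familyOne n) (2 / 3)) : 0 < t := by
  rcases Nat.eq_zero_or_pos t with rfl | h
  · obtain ⟨f₀, hf₀⟩ := familyZero_nonempty n
    obtain ⟨f₁, hf₁⟩ := familyOne_nonempty n
    have h0 := hM.1 f₀ hf₀
    have h1 := hM.2 f₁ hf₁
    have h2 := M.prob_add_prob f₀
    have h3 : M.prob f₁ true = M.prob f₀ true := by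
      simp only [PassiveQuantumTester.prob]
      congr 3
    linarith
  · exact h

lemma PassiveQuantumTester.Distinguishes.copies_ge {n t : ℕ}
    {M : PassiveQuantumTester (Input n) t}
    (hM : M.Distinguishes (familyZero n) (familyOne n) (2 / 3)) :
    1 / 64 * (2 : ℝ) ^ ((n : ℝ) / 2) ≤ (t : ℝ) := by
  have hpos : (0 : ℝ) < (2 : ℝ) ^ ((n : ℝ) / 2) := by positivity
  rcases Nat.lt_or_ge n 11 with hn | hn
  -- For small n the constant 1/64 makes the bound at most 1, so one copy already meets it.
  · have ht : (1 : ℝ) ≤ t := by exact_mod_cast hM.pos_copies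
    have hn' : (n : ℝ) / 2 ≤ 6 := by
      have : (n : ℝ) ≤ 11 := by exact_mod_cast hn.le
      linarith
    have h := Real.rpow_le_rpow_of_exponent_le (by norm_num : (1 : ℝ) ≤ 2) hn'
    have h6 : (2 : ℝ) ^ (6 : ℝ) = 64 := by
      rw [show (6 : ℝ) = ((6 : ℕ) : ℝ) by norm_num, Real.rpow_natCast]; norm_num
    linarith
  · have h0 := re_trace_effect_mul_ensembleZero_ge M hM
    have h1 := re_trace_effect_mul_ensembleOne_le M hM
    have h2 := norm_trace_mul_ensemble_diff_le (n := n) M.isContractive_effect_false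
    rw [Matrix.mul_sub, trace_sub] at h2
    have h3 := (Complex.re_le_norm _).trans h2
    rw [Complex.sub_re] at h3
    have h4 : (256 : ℝ) / 2 ^ n ≤ 1 / 8 := by
      rw [div_le_div_iff₀ (by positivity) (by norm_num)]
      have : (2 : ℝ) ^ 11 ≤ 2 ^ n := pow_le_pow_right₀ (by norm_num) hn
      linarith
    -- The gap between the averages is at least 2/3 · 7/8 - 1/3 = 1/4, against the upper bound
    -- 4t/2^{n/2}.
    have h5 : (1 / 64 : ℝ) ≤ (t : ℝ) / (2 : ℝ) ^ ((n : ℝ) / 2) := by linarith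
    rwa [le_div_iff₀ hpos] at h5

/-! ### Distance of the families -/

lemma l1Dist_family_ge {n : ℕ} {f₀ f₁ : Input n → Bool} (h₀ : f₀ ∈ familyZero n)
    (h₁ : f₁ ∈ familyOne n) : (1 / 64 : ℝ) ≤ l1Dist f₀ f₁ := by
  obtain ⟨A, B, C, hc, rfl⟩ := h₀
  obtain ⟨A', B', rfl⟩ := h₁
  have hN : (0 : ℝ) < 2 ^ n := by positivity
  have hcard : (Fintype.card (Input n) : ℝ) = 2 ^ n * 4 := by
    simp [Fintype.card_prod]
  rw [l1Dist, hcard, le_div_iff₀ (by positivity)]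
  rw [le_div_iff₀ hN] at hc
  have hsum : ((A ∩ B ∩ C).card : ℝ) ≤ ∑ x : Input n,
      |((tripleFun A B C x).toNat : ℝ) - ((tripleFun A' B' (symmDiff A' B') x).toNat : ℝ)| := by
    rw [Fintype.sum_prod_type, ← nsmul_one, ← Finset.sum_const]
    refine (Finset.sum_le_sum fun x hx => ?_).trans (Finset.sum_le_univ_sum_of_nonneg
      fun x => Finset.sum_nonneg fun a _ => abs_nonneg _)
    simp only [Finset.mem_inter] at hx
    simp only [Fintype.sum_prod_type, Fintype.sum_bool, tripleFun, hx.1.1, hx.1.2, hx.2,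
      Finset.mem_symmDiff]
    -- The table 111 has odd parity and every table (u, v, u ⊕ v) even parity, so they differ at
    -- some address.
    by_cases hA : x ∈ A' <;> by_cases hB : x ∈ B' <;> simp [hA, hB]
  linarith

/-! ### The classical algorithm -/

/-- Query the three values at each point of a list, and output `false` once all three are `true`. -/
def searchTree {n : ℕ} : List (Cube n) → DecisionTree (Input n)
  | [] => .leaf true
  | x :: l => .query (x, (false, false)) fun a => .query (x, (false, true)) fun b =>
      .query (x, (true, false)) fun c => if a && b && c then .leaf false else searchTree l

lemma depth_searchTree_le {n : ℕ} (l : List (Cube n)) : (searchTree l).depth ≤ 3 * l.length := by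
  induction l with
  | nil => simp [searchTree, DecisionTree.depth]
  | cons x l ih =>
    simp only [searchTree, DecisionTree.depth, List.length_cons, Bool.and_false,
      Bool.and_true, Bool.false_eq_true, if_true, if_false]
    omega

lemma eval_searchTree_eq_true_iff {n : ℕ} (g : Cube n → Bool × Bool × Bool) (l : List (Cube n)) :
    (searchTree l).eval (bitFun g) = true ↔ ∀ x ∈ l, x ∉ fullPoints g := by
  induction l with
  | nil => simp [searchTree, DecisionTree.eval]
  | cons x l ih =>
    rw [List.forall_mem_cons, ← ih]
    have hv : (bitFun g (x, (false, false)) && bitFun g (x, (false, true)) &&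
        bitFun g (x, (true, false))) = true ↔ x ∈ fullPoints g := by
      simp [bitFun, bitAt, fullPoints, Prod.ext_iff, and_assoc]
    simp only [searchTree, DecisionTree.eval]
    by_cases h : x ∈ fullPoints g
    · rw [if_pos (hv.mpr h)]
      simp [h, DecisionTree.eval]
    · rw [if_neg (mt hv.mp h)]
      simp [h]

/-- Search for a full point among `18` independent uniform samples. -/
noncomputable def searchAlgorithm (n : ℕ) : QueryAlgorithm (Input n) 54 where
  dist := (PMF.uniformOfFintype (Fin 18 → Cube n)).map fun z => searchTree (List.ofFn z)
  depth_le T hT := by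
    obtain ⟨z, -, rfl⟩ := (PMF.mem_support_map_iff _ _ _).mp hT
    simpa using depth_searchTree_le (List.ofFn z)

lemma searchAlgorithm_prob {n : ℕ} (f : Input n → Bool) (b : Bool) :
    (searchAlgorithm n).prob f b =
      ((Finset.univ.filter fun z : Fin 18 → Cube n =>
        (searchTree (List.ofFn z)).eval f = b).card : ℝ) / ((2 : ℝ) ^ n) ^ 18 := by
  classical
  have hc : ((2 : ℝ) ^ n) ^ 18 = Fintype.card (Fin 18 → Cube n) := by simp
  rw [hc, QueryAlgorithm.prob, searchAlgorithm, PMF.map_comp, ← PMF.toOuterMeasure_apply_singleton,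
    PMF.toOuterMeasure_map_apply, PMF.toOuterMeasure_uniformOfFintype_apply, ENNReal.toReal_div,
    ENNReal.toReal_natCast, ENNReal.toReal_natCast, Fintype.card_subtype]
  congr!

lemma searchAlgorithm_prob_true {n : ℕ} (g : Cube n → Bool × Bool × Bool) :
    (searchAlgorithm n).prob (bitFun g) true =
      (1 - ((fullPoints g).card : ℝ) / 2 ^ n) ^ 18 := by
  have hset : (Finset.univ.filter fun z : Fin 18 → Cube n =>
      (searchTree (List.ofFn z)).eval (bitFun g) = true) =
      Fintype.piFinset fun _ => (fullPoints g)ᶜ := by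
    ext z
    simp only [Finset.mem_filter, Finset.mem_univ, true_and, eval_searchTree_eq_true_iff,
      List.forall_mem_ofFn_iff, Fintype.mem_piFinset, Finset.mem_compl]
  have hN : (2 : ℝ) ^ n ≠ 0 := by positivity
  rw [searchAlgorithm_prob, hset, Fintype.card_piFinset_const, Finset.card_compl, Nat.cast_pow,
    Nat.cast_sub (Finset.card_le_univ _), ← div_pow, sub_div]
  congr 2
  simp

lemma searchAlgorithm_prob_add {n : ℕ} (f : Input n → Bool) :
    (searchAlgorithm n).prob f false + (searchAlgorithm n).prob f true = 1 := by
  have hN : ((2 : ℝ) ^ n) ^ 18 ≠ 0 := by positivity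
  rw [searchAlgorithm_prob, searchAlgorithm_prob, ← add_div, div_eq_one_iff_eq hN, add_comm]
  have h := Finset.card_filter_add_card_filter_not (s := Finset.univ)
    (fun z : Fin 18 → Cube n => (searchTree (List.ofFn z)).eval f = true)
  simp only [Bool.not_eq_true] at h
  have hc : ((Finset.univ : Finset (Fin 18 → Cube n)).card : ℝ) = ((2 : ℝ) ^ n) ^ 18 := by simp
  rw [← hc]
  exact_mod_cast h

lemma searchAlgorithm_distinguishes (n : ℕ) :
    (searchAlgorithm n).Distinguishes (familyZero n) (familyOne n) (2 / 3) := by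
  constructor
  · rintro f ⟨A, B, C, hc, rfl⟩
    rw [tripleFun_eq_bitFun]
    set g : Cube n → Bool × Bool × Bool :=
      fun x => (decide (x ∈ A), decide (x ∈ B), decide (x ∈ C)) with hg
    have h1 := searchAlgorithm_prob_add (bitFun g)
    have h2 := searchAlgorithm_prob_true g
    have h3 : fullPoints g = A ∩ B ∩ C := by
      ext x
      simp [fullPoints, hg]
    rw [h3] at h2
    have h4 : ((A ∩ B ∩ C).card : ℝ) / 2 ^ n ≤ 1 := by
      rw [div_le_one (by positivity)]
      have := Finset.card_le_univ (A ∩ B ∩ C)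
      simp only [Fintype.card_pi, Fintype.card_bool, Finset.prod_const, Finset.card_univ,
        Fintype.card_fin] at this
      exact_mod_cast this
    have h5 : (1 - ((A ∩ B ∩ C).card : ℝ) / 2 ^ n) ^ 18 ≤ (15 / 16 : ℝ) ^ 18 :=
      pow_le_pow_left₀ (by linarith) (by linarith) 18
    -- 18 is the least exponent for which this holds; three queries per sample give 54.
    have h6 : (15 / 16 : ℝ) ^ 18 ≤ 1 / 3 := by norm_num
    linarith
  · rintro f ⟨A, B, rfl⟩
    rw [tripleFun_symmDiff_eq_bitFun, searchAlgorithm_prob_true]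
    have h : fullPoints (fun x => withParity (decide (x ∈ A), decide (x ∈ B))) = ∅ := by
      ext x
      by_cases hA : x ∈ A <;> by_cases hB : x ∈ B <;> simp [fullPoints, withParity, hA, hB]
    rw [h]
    norm_num

theorem mainTheorem3 :
    -- the two families are non-empty and at distance at least `1/64`
    (∀ n : ℕ, (familyZero n).Nonempty ∧ (familyOne n).Nonempty ∧
      ∀ f₀ ∈ familyZero n, ∀ f₁ ∈ familyOne n, (1 / 64 : ℝ) ≤ l1Dist f₀ f₁) ∧
    -- passive quantum testers need `Ω(2^{n/2})` copies
    (∃ c : ℝ, 0 < c ∧ ∀ (n t : ℕ) (M : PassiveQuantumTester (Input n) t),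
      M.Distinguishes (familyZero n) (familyOne n) (2 / 3) →
        c * (2 : ℝ) ^ ((n : ℝ) / 2) ≤ (t : ℝ)) ∧
    -- a constant number of classical queries suffices
    (∃ q : ℕ, ∀ n : ℕ, ∃ R : QueryAlgorithm (Input n) q,
      R.Distinguishes (familyZero n) (familyOne n) (2 / 3)) ∧
    -- the averaged states agree on the distinct-input subspace
    (∀ n t : ℕ, distinctProj n t * ensembleZero n t * distinctProj n t =
      distinctProj n t * ensembleOne n t * distinctProj n t) ∧
    -- the projection moves them by `O(t / 2^{n/2})`, and they are `O(t / 2^{n/2})`-close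
    (∃ K : ℝ, 0 < K ∧ ∀ n t : ℕ,
      traceNorm (ensembleZero n t - distinctProj n t * ensembleZero n t * distinctProj n t) ≤
        K * ((t : ℝ) / (2 : ℝ) ^ ((n : ℝ) / 2)) ∧
      traceNorm (ensembleOne n t - distinctProj n t * ensembleOne n t * distinctProj n t) ≤
        K * ((t : ℝ) / (2 : ℝ) ^ ((n : ℝ) / 2)) ∧
      traceNorm (ensembleZero n t - ensembleOne n t) ≤
        K * ((t : ℝ) / (2 : ℝ) ^ ((n : ℝ) / 2))) := by
  refine ⟨fun n => ⟨familyZero_nonempty n, familyOne_nonempty n, fun f₀ h₀ f₁ h₁ =>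
    l1Dist_family_ge h₀ h₁⟩, ⟨1 / 64, by norm_num, fun n t M hM => hM.copies_ge⟩,
    ⟨54, fun n => ⟨searchAlgorithm n, searchAlgorithm_distinguishes n⟩⟩,
    distinctProj_mul_ensembleZero_mul_eq, ⟨4, by norm_num, fun n t => ?_⟩⟩
  have hpos : (0 : ℝ) ≤ (t : ℝ) / (2 : ℝ) ^ ((n : ℝ) / 2) := by positivity
  refine ⟨?_, ?_, ?_⟩
  · refine (traceNorm_le_of_forall_isContractive fun U hU =>
      norm_trace_mul_ensembleZero_sub_le hU).trans ?_
    linarith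
  · refine (traceNorm_le_of_forall_isContractive fun U hU =>
      norm_trace_mul_ensembleOne_sub_le hU).trans ?_
    linarith
  · exact traceNorm_le_of_forall_isContractive fun U hU => norm_trace_mul_ensemble_diff_le hU
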